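/- **Setting.** Let $\mathbb P=\mathbb P_\Sigma$ be a smooth projective toric variety of dimension $d$ over $\mathbb C$ whose fan $\Sigma$ has ray generators $e_1,\dots,e_n$ and torus-invariant divisors $D_1,\dots,D_n$. Let $R(\Sigma)\subset\mathbb Z^n$ be the lattice of integral relations $\sum_j l_je_j=0$ (identified with $H_2(\mathbb P,\mathbb Z)$, where $\lambda=(l_j)$ has intersection number $(D_j,\lambda)=l_j$), and let $K_{\rm eff}(\mathbb P)\subset R(\Sigma)\otimes\mathbb R$ be the Mori cone, i.e. the dual of the ample cone. For an ample divisor $H$ and a lattice point $\beta=(b_1,\dots,b_n)\in K_{\rm eff}(\mathbb P)$ with all $b_j\ge 0$, the *Morrison–Plesser moduli space* $\mathbb P_\beta$ is the projective toric variety given by the normal fan of the polytope $$\Delta_H^\beta=\Big\{x=(x^{(j)}_i)_{1\le j\le n,\ 0\le i\le b_j}\ :\ x^{(j)}_i\ge 0,\ \ \sum_j (D_j,\lambda)\sum_{i}x^{(j)}_i=(H,\lambda)\ \ \forall\lambda\in R(\Sigma)\Big\};$$ it does not depend on $H$. Let $[D_j]\in H^2(\mathbb P_\beta,\mathbb Q)$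 also denote the common class of the divisors $x^{(j)}_i=0$ $(0\le i\le b_j)$ of $\mathbb P_\beta$, and let $\Phi_\beta=([D_1]+\cdots+[D_n])^{b_1+\cdots+b_n}\in H^*(\mathbb P_\beta,\mathbb Q)$ be the *Morrison–Plesser class*. For a homogeneous polynomial $P\in\mathbb Q[x_1,\dots,x_n]$ of degree $d$ put $$I(P,\beta)=\int_{\mathbb P_\beta}P([D_1],\dots,[D_n])\,\Phi_\beta,\qquad I_P=\sum_{\beta}I(P,\beta)\,a^\beta ,\qquad a^\beta=a_1^{b_1}\cdots a_n^{b_n},$$ where $\beta$ runs over the lattice points of $K_{\rm eff}(\mathbb P)$. **Theorem.** Let $d_1,\dots,d_r\ge 1$ be integers, $n_j=d_j+1$, $d=d_1+\cdots+d_r$, and let $\mathbb P=\mathbb P^{d_1}\times\cdots\times\mathbb P^{d_r}$. Index the torus-invariant prime divisors as $D_{ji}$ $(1\le j\le r,\ 1\le i\le n_j)$, where $D_{j1},\dots,D_{jn_j}$ come from the coordinate hyperplanes of $\mathbb P^{d_j}$; use variables $x_{ji}$ and $a_{ji}$ accordingly. 1. The lattice points of $K_{\rm eff}(\mathbb P)$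 are exactly the vectors $\beta$ with coordinates $\beta_{ji}=b_j$ for some $(b_1,\dots,b_r)\in\mathbb Z_{\ge 0}^r$. 2. For such $\beta$, regrouping homogeneous coordinates gives an isomorphism $\mathbb P_\beta\cong\mathbb P^{n_1b_1+d_1}\times\cdots\times\mathbb P^{n_rb_r+d_r}$ of toric varieties. 3. Let $k=(k_{ji})$ be nonnegative integers with $\sum_{j,i}k_{ji}=d$, and put $x^k=\prod_{j,i}x_{ji}^{k_{ji}}$, $k_j=\sum_i k_{ji}$, $u_j=n_j^{n_j}a_{j1}\cdots a_{jn_j}$. Then, as formal power series in the variables $a_{ji}$, $$I_{x^k}=n_1^{d_1-k_1}\cdots n_r^{d_r-k_r}\sum_{b_1,\dots,b_r\ge 0}\frac{(n_1b_1+\cdots+n_rb_r)!}{(n_1b_1+d_1-k_1)!\cdots(n_rb_r+d_r-k_r)!}\,u_1^{b_1}\cdots u_r^{b_r},$$ where $1/m!$ is understood to be $0$ for negative integers $m$. -/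

import Mathlib

open scoped BigOperators LinearAlgebra.Projectivization

noncomputable section

namespace ToricMP

/-! ### Fans and toric varieties -/

/-- The combinatorial data of a simplicial fan in the lattice `N`: the ray generators `e_i`, indexed
by `ι`, and the collection of all index sets `I` such that the `e_i`, `i ∈ I`, generate a cone of
the fan. -/
structure FanData (N : Type) [AddCommGroup N] (ι : Type) where
  ray : ι → N
  cones : Set (Finset ι)

section General

variable {N : Type} [AddCommGroup N] {ι : Type} [Fintype ι]

/-- The dimension `d` of the toric variety: the rank of the lattice. -/
def FanData.dim (_F : FanData N ι) : ℕ := Module.finrank ℤ N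

/-- The index sets of the `d`-dimensional cones of a simplicial fan. -/
def FanData.maxCones (F : FanData N ι) : Set (Finset ι) :=
  {I | I ∈ F.cones ∧ I.card = F.dim}

/-- The group `R(Σ)` of integral relations `l_1 e_1 + ⋯ + l_n e_n = 0`; it is the lattice of
integral points in `H_2(ℙ)`, the intersection number of `λ ∈ R(Σ)` with `D_j` being `λ j`. -/
def FanData.relations (F : FanData N ι) : AddSubgroup (ι → ℤ) where
  carrier := {l | ∑ i, l i • F.ray i = 0}
  zero_mem' := by simp
  add_mem' := by
    intro a b ha hb
    simp only [Set.mem_ofPred_eq] at ha hb ⊢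
    simp [add_smul, Finset.sum_add_distrib, ha, hb]
  neg_mem' := by
    intro a ha
    simp only [Set.mem_ofPred_eq] at ha ⊢
    simp [neg_smul, Finset.sum_neg_distrib, ha]

/-- The real divisor `∑ c_i D_i` is ample: its piecewise linear support function is strictly convex,
that is, for every maximal cone `σ` the divisor is linearly equivalent to a divisor whose
coefficients vanish at the rays of `σ` and are positive at all other rays. -/
def FanData.IsAmple (F : FanData N ι) (c : ι → ℝ) : Prop :=
  ∀ I ∈ F.maxCones, ∃ m : N →+ ℝ,
    (∀ i ∈ I, c i + m (F.ray i) = 0) ∧ ∀ i ∉ I, 0 < c i + m (F.ray i)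

/-- The integral divisor `∑ c_i D_i` is an ample Cartier divisor: as before, with linear
functions `m` in the character lattice `Hom(N, ℤ)`. -/
def FanData.IsAmpleCartier (F : FanData N ι) (c : ι → ℤ) : Prop :=
  ∀ I ∈ F.maxCones, ∃ m : N →+ ℤ,
    (∀ i ∈ I, c i + m (F.ray i) = 0) ∧ ∀ i ∉ I, 0 < c i + m (F.ray i)

/-- The integral points of the Mori cone `K_eff`: the elements of `R(Σ)` that are nonnegative on the
ample cone (equivalently, on its closure). -/
def FanData.moriPoints (F : FanData N ι) : Set (ι → ℤ) :=
  {β | β ∈ F.relations ∧ ∀ c : ι → ℝ, F.IsAmple c → 0 ≤ ∑ i, c i * (β i : ℝ)}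

/-- The Stanley–Reisner ideal of the fan. -/
def FanData.srIdeal (F : FanData N ι) : Ideal (MvPolynomial ι ℚ) :=
  Ideal.span {p | ∃ I : Finset ι, I ∉ F.cones ∧ p = ∏ i ∈ I, MvPolynomial.X i}

/-- The ideal of linear relations: `∑ ⟨m, e_i⟩ D_i` is the divisor of the character `m`. -/
def FanData.linIdeal (F : FanData N ι) : Ideal (MvPolynomial ι ℚ) :=
  Ideal.span {p | ∃ m : N →+ ℤ,
    p = ∑ i, MvPolynomial.C (m (F.ray i) : ℚ) * MvPolynomial.X i}

/-- The rational cohomology ring `H^*(X_Σ, ℚ)` (which is also the rational Chow ring) of the complete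
simplicial toric variety `X_Σ`, generated by the classes of the torus-invariant divisors subject to
the Stanley–Reisner relations and the linear equivalences.
The classes of forms of degree `k` make up `H^{2k}`. -/
abbrev FanData.Cohomology (F : FanData N ι) : Type :=
  MvPolynomial ι ℚ ⧸ (F.srIdeal ⊔ F.linIdeal)

/-- The class `[D_i]` of the torus-invariant prime divisor of the `i`-th ray. -/
def FanData.divisor (F : FanData N ι) (i : ι) : F.Cohomology :=
  Ideal.Quotient.mk _ (MvPolynomial.X i)

/-- The multiplicity of a full-dimensional simplicial cone: the index in `N` of the sublattice
generated by its ray generators. -/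
def FanData.mult (F : FanData N ι) (I : Finset ι) : ℕ :=
  (AddSubgroup.closure (F.ray '' (I : Set ι))).index

/-- `ℓ` is the integration functional `H^*(X_Σ, ℚ) → ℚ`: it vanishes outside of the top degree
`H^{2d}`, and the divisors of the rays of a `d`-dimensional cone `σ` have the intersection number
`1 / mult(σ)`. -/
def FanData.IsIntegral (F : FanData N ι) (ℓ : F.Cohomology →ₗ[ℚ] ℚ) : Prop :=
  (∀ (k : ℕ) (p : MvPolynomial ι ℚ), p.IsHomogeneous k → k ≠ F.dim →
    ℓ (Ideal.Quotient.mk _ p) = 0) ∧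
  ∀ I ∈ F.maxCones, ℓ (∏ i ∈ I, F.divisor i) = 1 / (F.mult I : ℚ)

open Classical in
/-- Integration `∫_{X_Σ}` of cohomology classes. -/
def FanData.integral (F : FanData N ι) : F.Cohomology →ₗ[ℚ] ℚ :=
  if h : ∃ ℓ, F.IsIntegral ℓ then h.choose else 0

/-- The open set `U(Σ) ⊆ ℂ^n` of homogeneous coordinates: the coordinates that vanish belong to a
common cone. -/
def FanData.U (F : FanData N ι) : Set (ι → ℂ) :=
  {z | ∃ I ∈ F.cones, ∀ i ∉ I, z i ≠ 0}

/-- The group `G ⊆ (ℂ^*)^n` with character group `Cl(X_Σ) = ℤ^n / Hom(N, ℤ)`. -/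
def FanData.G (F : FanData N ι) : Subgroup (ι → ℂˣ) where
  carrier := {t | ∀ m : N →+ ℤ, ∏ i, t i ^ m (F.ray i) = 1}
  one_mem' := by intro m; simp
  mul_mem' := by
    intro a b ha hb m
    simp only [Pi.mul_apply, mul_zpow, Finset.prod_mul_distrib, ha m, hb m, mul_one]
  inv_mem' := by
    intro a ha m
    simp only [Pi.inv_apply, inv_zpow, Finset.prod_inv_distrib, ha m, inv_one]

/-- Two points of `U(Σ)` lie in the same `G`-orbit. -/
def FanData.orbitSetoid (F : FanData N ι) : Setoid F.U where
  r z w := ∃ t ∈ F.G, ∀ i, w.1 i = (t i : ℂ) * z.1 i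
  iseqv :=
    { refl := fun z => ⟨1, F.G.one_mem, by simp⟩
      symm := by
        rintro z w ⟨t, ht, h⟩
        exact ⟨t⁻¹, F.G.inv_mem ht, fun i => by simp [h i]⟩
      trans := by
        rintro z w v ⟨t, ht, h⟩ ⟨s, hs, h'⟩
        exact ⟨s * t, F.G.mul_mem hs ht, fun i => by simp [h i, h' i, mul_assoc]⟩ }

/-- The (points of the) toric variety `X_Σ = U(Σ) / G`, with the quotient topology. -/
def FanData.Variety (F : FanData N ι) : Type := Quotient F.orbitSetoid

instance (F : FanData N ι) : TopologicalSpace F.Variety :=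
  inferInstanceAs (TopologicalSpace (Quotient F.orbitSetoid))

/-- The point of `X_Σ` with given homogeneous coordinates. -/
def FanData.point (F : FanData N ι) (z : F.U) : F.Variety := Quotient.mk F.orbitSetoid z

/-! ### Morrison–Plesser moduli spaces -/

/-- The coordinates `x_i^{(j)}`, `0 ≤ i ≤ b_j`, of `ℤ(β)`; there are none if `b_j < 0`. -/
abbrev Idx (β : ι → ℤ) : Type := Σ j : ι, Fin (β j + 1).toNat

/-- The polytope `Δ_H^β ⊆ ℝ_{≥ 0}(β)`. -/
def FanData.mpPolytope (F : FanData N ι) (H β : ι → ℤ) : Set (Idx β → ℝ) :=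
  {x | (∀ ρ, 0 ≤ x ρ) ∧ ∀ l ∈ F.relations,
    ∑ j, (l j : ℝ) * ∑ i : Fin (β j + 1).toNat, x ⟨j, i⟩ = ∑ j, (l j : ℝ) * (H j : ℝ)}

/-- The character lattice of the torus of `ℙ_β`: the integral vectors `x ∈ ℤ(β)` for which the divisor
`∑_j (∑_i x_i^{(j)}) D_j` is linearly equivalent to zero, i.e. the differences of those lattice
points for which this divisor is linearly equivalent to `H`. -/
def FanData.mpLattice (F : FanData N ι) (β : ι → ℤ) : AddSubgroup (Idx β → ℤ) where
  carrier := {x | ∃ m : N →+ ℤ, ∀ j, ∑ i : Fin (β j + 1).toNat, x ⟨j, i⟩ = m (F.ray j)}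
  zero_mem' := ⟨0, by simp⟩
  add_mem' := by
    rintro a b ⟨m, hm⟩ ⟨m', hm'⟩
    exact ⟨m + m', fun j => by simp [Finset.sum_add_distrib, hm, hm']⟩
  neg_mem' := by
    rintro a ⟨m, hm⟩
    exact ⟨-m, fun j => by simp [Finset.sum_neg_distrib, hm]⟩

/-- The normal fan `Σ_β` of the polytope `Δ_H^β`, whose variety is the Morrison–Plesser moduli space
`ℙ_β`. The facet `x_ρ = 0` has as normal vector the coordinate function `x_ρ`, an element of the
dual of the character lattice; a set of normal vectors generates a cone of the normal fan iff the
corresponding facets have a common point in the polytope. -/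
def FanData.mpFan (F : FanData N ι) (H β : ι → ℤ) :
    FanData (F.mpLattice β →+ ℤ) (Idx β) where
  ray ρ := (Pi.evalAddMonoidHom (fun _ : Idx β => ℤ) ρ).comp (F.mpLattice β).subtype
  cones := {I | ∃ x ∈ F.mpPolytope H β, ∀ ρ ∈ I, x ρ = 0}

/-- The rational divisor `∑ q_ρ D_{j(ρ)}` (where `j(ρ) = j` for the coordinate `ρ = (j, i)`) on the
original variety is linearly equivalent to `D_j` over `ℚ`. -/
def FanData.IsLift [DecidableEq ι] (F : FanData N ι) (β : ι → ℤ) (j : ι) (q : Idx β → ℚ) : Prop :=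
  ∃ m : N →+ ℚ, ∀ j', ∑ i : Fin (β j' + 1).toNat, q ⟨j', i⟩ =
    (if j' = j then 1 else 0) + m (F.ray j')

open Classical in
/-- The image `[D_j] ∈ H^2(ℙ_β, ℚ)` of `[D_j] ∈ H^2(ℙ, ℚ)` under the canonical homomorphism `ψ_β`.
If `b_j ≥ 0`, it is the class of the (linearly equivalent) divisors `x_i^{(j)} = 0` on `ℙ_β`. If
`b_j < 0`, one first writes `D_j` up to linear equivalence as a rational combination of
divisors `D_{j'}` with `b_{j'} ≥ 0`. -/
def FanData.mpDivisor (F : FanData N ι) (H β : ι → ℤ) (j : ι) : (F.mpFan H β).Cohomology :=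
  if h : 0 ≤ β j then (F.mpFan H β).divisor ⟨j, ⟨0, by omega⟩⟩
  else if h' : ∃ q, F.IsLift β j q then ∑ ρ, h'.choose ρ • (F.mpFan H β).divisor ρ
  else 0

/-- The Morrison–Plesser class
`Φ_β = ([D_1] + ⋯ + [D_n])^{b_1 + ⋯ + b_n} ∏_{b_j < 0} [D_j]^{-b_j-1}`. -/
def FanData.mpClass (F : FanData N ι) (H β : ι → ℤ) : (F.mpFan H β).Cohomology :=
  (∑ j, F.mpDivisor H β j) ^ (∑ j, β j).toNat *
    ∏ j with β j < 0, F.mpDivisor H β j ^ (-β j - 1).toNat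

/-- The intersection number `I(P, β) = ∫_{ℙ_β} P([D_1], …, [D_n]) Φ_β`. -/
def FanData.mpNumber (F : FanData N ι) (H : ι → ℤ) (P : MvPolynomial ι ℚ) (β : ι → ℤ) : ℚ :=
  (F.mpFan H β).integral (MvPolynomial.aeval (F.mpDivisor H β) P * F.mpClass H β)

open Classical in
/-- The generating function `I_P(a) = ∑_{β ∈ K_eff} I(P, β) a^β` as a formal power series, in case all
integral points of the Mori cone have nonnegative coordinates. -/
def FanData.mpSeries (F : FanData N ι) (H : ι → ℤ) (P : MvPolynomial ι ℚ) : MvPowerSeries ι ℚ :=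
  fun b => if (fun i => (b i : ℤ)) ∈ F.moriPoints then F.mpNumber H P (fun i => (b i : ℤ)) else 0

end General

/-- An isomorphism of fans along a given bijection of the rays: an isomorphism of lattices that maps
ray generators to ray generators and cones to cones. -/
def IsFanIso {N N' ι ι' : Type} [AddCommGroup N] [AddCommGroup N']
    (F : FanData N ι) (F' : FanData N' ι') (e : ι ≃ ι') : Prop :=
  (∃ φ : N ≃+ N', ∀ i, φ (F.ray i) = F'.ray (e i)) ∧
    ∀ I : Finset ι, I ∈ F.cones ↔ I.map e.toEmbedding ∈ F'.cones

/-! ### Products of projective spaces -/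

/-- The fan of `ℙ^m` in `ℤ^m`: the rays are generated by the standard basis vectors and by minus their
sum, and the cones are generated by the proper subsets of these vectors. -/
def projFan (m : ℕ) : FanData (Fin m → ℤ) (Fin (m + 1)) where
  ray := Fin.snoc (α := fun _ => Fin m → ℤ) (fun i => Pi.single i 1) (fun _ => -1)
  cones := {I | I ≠ Finset.univ}

/-- The fan of `ℙ^{d_1} × ⋯ × ℙ^{d_r}` in `ℤ^{d_1} ⊕ ⋯ ⊕ ℤ^{d_r}`, the product of the fans of
the `ℙ^{d_j}`. Its rays are indexed by the pairs `(j, i)` with `0 ≤ i ≤ d_j`. -/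
def prodProjFan {r : ℕ} (d : Fin r → ℕ) :
    FanData (∀ j, Fin (d j) → ℤ) (Σ j : Fin r, Fin (d j + 1)) where
  ray p := Pi.single p.1 ((projFan (d p.1)).ray p.2)
  cones := {I | ∀ j, I.preimage (Sigma.mk j) sigma_mk_injective.injOn ∈ (projFan (d j)).cones}

/-- The topology of complex projective space. -/
instance projTopology (m : ℕ) : TopologicalSpace (ℙ ℂ (Fin (m + 1) → ℂ)) :=
  inferInstanceAs (TopologicalSpace
    (Quotient (projectivizationSetoid ℂ (Fin (m + 1) → ℂ))))

/-- The reciprocal factorial `1 / m!` of an integer, equal to `0` if `m < 0`. -/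
def invFactorial (m : ℤ) : ℚ := if 0 ≤ m then 1 / (m.toNat.factorial : ℚ) else 0

end ToricMP

end

/-!
A product of projective spaces is characterised among toric varieties by its rays falling into groups
such that the relations among the rays are generated by the sums over the groups, while a set of
rays spans a cone iff it contains no entire group (`FanData.IsProjProduct`). Everything rests on the
fact that the Morrison–Plesser fan is of this kind (`isFanIso_mpFan`): both its lattice and its
polytope are described by sums over the groups of coordinates `x_i^{(p)}` whose rays `p` come from
the same factor `ℙ^{d_j}`. There are `(d_j + 1) (b_j + 1)` of these, and the polytope is a product of
simplices, of sizes given by the positive degrees of the ample divisor `H` on the factors.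

For a fan of this kind the quotient construction gives the product of the projective spaces
(`FanData.IsProjProduct.exists_homeomorph`). The cohomology ring is `ℚ[y_j] / (y_j ^ (s_j + 1))`,
where all the divisors of the `j`-th group are sent to `y_j`, so that there is exactly one
integration functional: the coefficient of `∏ y_j ^ s_j`
(`FanData.IsProjProduct.isIntegral_apply`). An intersection number is therefore the coefficient
of `∏ y_j ^ s_j` in `∏ y_j ^ k_j · (∑ (d_j + 1) y_j) ^ N`, with `N` the sum of the coordinates of `β`,
which the multinomial theorem evaluates (`coeff_monomial_mul_linear_pow`).

The Mori cone is found by pairing with divisors all of whose coefficients are positive, which are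
ample (`moriPoints_prodProjFan`). As different curve classes `β` have different exponents `a^β`, each
coefficient of the generating function receives at most one summand (`hasSum_mpSeries`).
-/

namespace ToricMP

/-! ### Fans of products of projective spaces -/

section ProjProduct

variable {N : Type} [AddCommGroup N] {ι : Type} [Fintype ι] {κ : Type} [Fintype κ] [DecidableEq κ]

/-- `F` is a fan of a product of projective spaces indexed by `κ`, the rays of the `j`-th factor
being the fibre of `π` over `j`: the rays in each fibre add up to zero, there are no other relations
(every function on the rays with vanishing fibre sums is given by a character), the rays generate
the lattice, and a set of rays spans a cone iff it contains no entire fibre. -/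
structure FanData.IsProjProduct (F : FanData N ι) (π : ι → κ) : Prop where
  surjective : Function.Surjective π
  mem_cones_iff : ∀ I : Finset ι, I ∈ F.cones ↔ ∀ j, ∃ ρ ∉ I, π ρ = j
  sum_ray : ∀ j, ∑ ρ with π ρ = j, F.ray ρ = 0
  exists_hom : ∀ a : ι → ℤ, (∀ j, ∑ ρ with π ρ = j, a ρ = 0) →
    ∃ m : N →+ ℤ, ∀ ρ, m (F.ray ρ) = a ρ
  closure_ray : AddSubgroup.closure (Set.range F.ray) = ⊤
  dim_add_card : F.dim + Fintype.card κ = Fintype.card ι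

/-- The dimensions of the factors: one less than the number of rays of each factor. -/
noncomputable def fibreDim (π : ι → κ) : κ →₀ ℕ :=
  Finsupp.equivFunOnFinite.symm fun j => (Finset.univ.filter fun ρ => π ρ = j).card - 1

theorem fibreDim_add_one {π : ι → κ} (hπ : Function.Surjective π) (j : κ) :
    fibreDim π j + 1 = (Finset.univ.filter fun ρ => π ρ = j).card := by
  obtain ⟨ρ, hρ⟩ := hπ j
  have : 0 < (Finset.univ.filter fun ρ => π ρ = j).card :=
    Finset.card_pos.2 ⟨ρ, by simp [hρ]⟩
  simp only [fibreDim, Finsupp.equivFunOnFinite_symm_apply_apply]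
  omega

namespace FanData.IsProjProduct

variable {F : FanData N ι} {π : ι → κ} (h : F.IsProjProduct π)
include h

theorem degree_fibreDim : (fibreDim π).degree = F.dim := by
  have h1 : ∑ j, (fibreDim π j + 1) = Fintype.card ι := by
    simp_rw [fibreDim_add_one h.surjective]
    rw [← Finset.card_univ, Finset.card_eq_sum_card_fiberwise (f := π) (t := Finset.univ)]
    simp
  have h2 := h.dim_add_card
  rw [Finset.sum_add_distrib] at h1
  simp only [Finset.sum_const, Finset.card_univ, smul_eq_mul, mul_one] at h1
  rw [Finsupp.degree_eq_sum]
  omega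

/-- A maximal cone omits exactly one ray of each factor. -/
theorem exists_section {I : Finset ι} (hI : I ∈ F.maxCones) :
    ∃ g : κ → ι, (∀ j, π (g j) = j) ∧ ∀ ρ, ρ ∉ I ↔ ρ = g (π ρ) := by
  classical
  obtain ⟨hI, hc⟩ := hI
  choose g hg hπ using (h.mem_cones_iff I).1 hI
  refine ⟨g, hπ, fun ρ => ⟨fun hρ => ?_, fun hρ => hρ ▸ hg _⟩⟩
  have hinj : Function.Injective g := fun a b hab => by rw [← hπ a, hab, hπ]
  have hsub : Finset.univ.image g ⊆ Iᶜ := by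
    intro x hx
    obtain ⟨j, -, rfl⟩ := Finset.mem_image.1 hx
    simpa using hg j
  have heq : Finset.univ.image g = Iᶜ := by
    refine Finset.eq_of_subset_of_card_le hsub ?_
    rw [Finset.card_image_of_injective _ hinj, Finset.card_compl, Finset.card_univ, hc,
      ← h.dim_add_card]
    omega
  have : ρ ∈ Finset.univ.image g := by rw [heq]; simpa using hρ
  obtain ⟨j, -, rfl⟩ := Finset.mem_image.1 this
  rw [hπ]

/-- Omitting one ray of each factor gives a maximal cone. -/
theorem mem_maxCones_of_section [DecidableEq ι] {g : κ → ι} (hg : ∀ j, π (g j) = j) :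
    (Finset.univ.image g)ᶜ ∈ F.maxCones := by
  have hinj : Function.Injective g := fun a b hab => by rw [← hg a, hab, hg]
  refine ⟨(h.mem_cones_iff _).2 fun j => ⟨g j, by simp, hg j⟩, ?_⟩
  rw [Finset.card_compl, Finset.card_image_of_injective _ hinj, Finset.card_univ,
    ← h.dim_add_card]
  omega

/-- The rays of a maximal cone generate the lattice, since the omitted ray of each factor is minus the
sum of the others. -/
theorem mult_eq_one {I : Finset ι} (hI : I ∈ F.maxCones) : F.mult I = 1 := by
  classical
  obtain ⟨g, hg, hgI⟩ := h.exists_section hI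
  rw [FanData.mult, AddSubgroup.index_eq_one, eq_top_iff, ← h.closure_ray,
    AddSubgroup.closure_le]
  rintro _ ⟨ρ, rfl⟩
  by_cases hρ : ρ ∈ I
  · exact AddSubgroup.subset_closure ⟨ρ, hρ, rfl⟩
  · have hs := h.sum_ray (π ρ)
    rw [← Finset.add_sum_erase _ _ (show ρ ∈ Finset.univ.filter (fun ρ' => π ρ' = π ρ) by simp)]
      at hs
    rw [eq_neg_of_add_eq_zero_left hs]
    refine neg_mem (sum_mem fun σ hσ => AddSubgroup.subset_closure ⟨σ, ?_, rfl⟩)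
    simp only [Finset.mem_erase, Finset.mem_filter, Finset.mem_univ, true_and] at hσ
    by_contra hσI
    have h1 := (hgI σ).1 hσI
    rw [hσ.2, ← (hgI ρ).1 hρ] at h1
    exact hσ.1 h1

theorem sum_hom_ray {A : Type*} [AddCommGroup A] (m : N →+ A) (j : κ) :
    ∑ ρ with π ρ = j, m (F.ray ρ) = 0 := by
  rw [← map_sum, h.sum_ray, map_zero]

/-! ### The cohomology of a product of projective spaces -/

open MvPolynomial in
theorem rename_prod_fibre (j : κ) :
    rename π (∏ ρ with π ρ = j, X ρ : MvPolynomial ι ℚ) = X j ^ (fibreDim π j + 1) := by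
  rw [map_prod, fibreDim_add_one h.surjective, ← Finset.prod_const]
  refine Finset.prod_congr rfl fun ρ hρ => ?_
  rw [rename_X, (Finset.mem_filter.1 hρ).2]

open MvPolynomial in
theorem rename_prod_maxCone {I : Finset ι} (hI : I ∈ F.maxCones) :
    rename π (∏ ρ ∈ I, X ρ : MvPolynomial ι ℚ) = monomial (fibreDim π) 1 := by
  classical
  obtain ⟨g, hg, hgI⟩ := h.exists_section hI
  rw [map_prod, monomial_eq, C_1, one_mul, Finsupp.prod_fintype _ _ (by simp),
    ← Finset.prod_fiberwise I π]
  refine Finset.prod_congr rfl fun j _ => ?_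
  have hcard : (I.filter fun ρ => π ρ = j).card = fibreDim π j := by
    have : (Finset.univ.filter fun ρ => π ρ = j) = insert (g j) (I.filter fun ρ => π ρ = j) := by
      ext ρ
      simp only [Finset.mem_filter, Finset.mem_univ, true_and, Finset.mem_insert]
      constructor
      · intro hρ
        by_cases hI : ρ ∈ I
        · exact Or.inr ⟨hI, hρ⟩
        · exact Or.inl (by rw [(hgI ρ).1 hI, hρ])
      · rintro (rfl | hρ)
        · exact hg j
        · exact hρ.2
    have h1 := fibreDim_add_one h.surjective j
    rw [this, Finset.card_insert_of_notMem] at h1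
    · omega
    · intro hmem
      exact (hgI (g j)).2 (by rw [hg]) (Finset.mem_filter.1 hmem).1
  rw [← hcard, ← Finset.prod_const]
  refine Finset.prod_congr rfl fun ρ hρ => ?_
  rw [rename_X, (Finset.mem_filter.1 hρ).2]

open MvPolynomial in
/-- Identifying the divisors of each factor maps the relations of the cohomology ring into the ideal
generated by the powers `y_j ^ (s_j + 1)`, which does not involve the monomial `∏ y_j ^ s_j`. -/
theorem coeff_rename_eq_zero {p : MvPolynomial ι ℚ} (hp : p ∈ F.srIdeal ⊔ F.linIdeal) :
    coeff (fibreDim π) (rename π p) = 0 := by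
  classical
  set J : Ideal (MvPolynomial κ ℚ) := Ideal.span
    ((fun s => monomial s (1 : ℚ)) '' Set.range fun j => Finsupp.single j (fibreDim π j + 1)) with hJ
  have hle : F.srIdeal ⊔ F.linIdeal ≤ J.comap (rename π).toRingHom := by
    refine sup_le (Ideal.span_le.2 ?_) (Ideal.span_le.2 ?_)
    · rintro _ ⟨I, hI, rfl⟩
      rw [h.mem_cones_iff] at hI
      push Not at hI
      obtain ⟨j, hj⟩ := hI
      have hsub : (Finset.univ.filter fun ρ => π ρ = j) ⊆ I := by
        intro ρ hρ
        by_contra hρI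
        exact hj ρ hρI (Finset.mem_filter.1 hρ).2
      obtain ⟨q, hq⟩ := Finset.prod_dvd_prod_of_subset _ _ (fun ρ => (X ρ : MvPolynomial ι ℚ)) hsub
      change rename π (∏ i ∈ I, X i) ∈ J
      rw [hq, map_mul, h.rename_prod_fibre]
      refine J.mul_mem_right _ (Ideal.subset_span ⟨_, ⟨j, rfl⟩, ?_⟩)
      simp [X_pow_eq_monomial]
    · rintro _ ⟨m, rfl⟩
      change rename π (∑ i, C (m (F.ray i) : ℚ) * X i) ∈ J
      have : rename π (∑ i, C (m (F.ray i) : ℚ) * X i : MvPolynomial ι ℚ) = 0 := by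
        simp only [map_sum, map_mul, rename_C, rename_X]
        rw [← Finset.sum_fiberwise Finset.univ π]
        refine Finset.sum_eq_zero fun j _ => ?_
        have : ∀ ρ ∈ Finset.univ.filter (fun ρ => π ρ = j),
            (C (m (F.ray ρ) : ℚ) * X (π ρ) : MvPolynomial κ ℚ) = C (m (F.ray ρ) : ℚ) * X j := by
          intro ρ hρ
          rw [(Finset.mem_filter.1 hρ).2]
        rw [Finset.sum_congr rfl this, ← Finset.sum_mul, ← map_sum, ← Int.cast_sum,
          h.sum_hom_ray]
        simp
      rw [this]
      exact J.zero_mem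
  have hmem : rename π p ∈ J := hle hp
  rw [hJ, mem_ideal_span_monomial_image] at hmem
  by_contra hne
  obtain ⟨_, ⟨j, rfl⟩, hj⟩ := hmem _ (mem_support_iff.2 hne)
  have := hj j
  simp at this

open MvPolynomial in
theorem exists_isIntegral : ∃ ℓ, F.IsIntegral ℓ := by
  classical
  let L : MvPolynomial ι ℚ →ₗ[ℚ] ℚ := lcoeff ℚ (fibreDim π) ∘ₗ (rename π).toLinearMap
  have hL : ∀ p ∈ (F.srIdeal ⊔ F.linIdeal).restrictScalars ℚ, L p = 0 :=
    fun p hp => h.coeff_rename_eq_zero hp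
  refine ⟨Submodule.liftQ ((F.srIdeal ⊔ F.linIdeal).restrictScalars ℚ) L hL, ?_, ?_⟩
  · intro k p hp hk
    change coeff (fibreDim π) (rename π p) = 0
    refine (hp.rename_isHomogeneous).coeff_eq_zero ?_
    rw [h.degree_fibreDim]
    exact hk.symm
  · intro I hI
    have : (∏ i ∈ I, F.divisor i) = Ideal.Quotient.mk _ (∏ i ∈ I, X i) := (map_prod _ _ _).symm
    rw [this, h.mult_eq_one hI]
    change coeff (fibreDim π) (rename π (∏ i ∈ I, X i)) = _
    rw [h.rename_prod_maxCone hI]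
    simp

theorem divisor_eq {ρ σ : ι} (hρ : π ρ = π σ) : F.divisor ρ = F.divisor σ := by
  classical
  obtain ⟨m, hm⟩ := h.exists_hom (Pi.single ρ 1 - Pi.single σ 1) (by
    intro j
    simp [Finset.sum_sub_distrib, hρ])
  refine Ideal.Quotient.eq.2 (Ideal.mem_sup_right (Ideal.subset_span ⟨m, ?_⟩))
  simp only [hm, Pi.sub_apply, Int.cast_sub, MvPolynomial.C_sub, sub_mul, Finset.sum_sub_distrib]
  rw [Finset.sum_eq_single ρ, Finset.sum_eq_single σ] <;> simp +contextual

open MvPolynomial in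
/-- The integration functional is unique: modulo the relations every polynomial in the divisors is a
polynomial in the hyperplane classes `y_j` of the factors, of which only the monomial
`∏ y_j ^ s_j` survives in top degree. -/
theorem isIntegral_apply {ℓ : F.Cohomology →ₗ[ℚ] ℚ} (hℓ : F.IsIntegral ℓ) (p : MvPolynomial ι ℚ) :
    ℓ (Ideal.Quotient.mk _ p) = coeff (fibreDim π) (rename π p) := by
  classical
  obtain ⟨g, hg⟩ := h.surjective.hasRightInverse
  let Θ : MvPolynomial κ ℚ →ₐ[ℚ] F.Cohomology := aeval fun j => F.divisor (g j)
  have hΘ : ∀ p, Θ (rename π p) = Ideal.Quotient.mk _ p := by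
    intro p
    have : Θ.comp (rename π) = Ideal.Quotient.mkₐ ℚ (F.srIdeal ⊔ F.linIdeal) := by
      ext ρ
      simp only [AlgHom.comp_apply, rename_X, Θ, aeval_X]
      exact h.divisor_eq (hg _)
    exact DFunLike.congr_fun this p
  have hΘ' : ∀ q, Θ q = Ideal.Quotient.mk _ (rename g q) := by
    intro q
    rw [← hΘ, rename_rename, show π ∘ g = id from funext hg, rename_id_apply]
  have hX : ∀ j, Θ (X j ^ (fibreDim π j + 1)) = 0 := by
    intro j
    rw [← h.rename_prod_fibre, hΘ]
    refine Ideal.Quotient.eq_zero_iff_mem.2 (Ideal.mem_sup_left (Ideal.subset_span ⟨_, ?_, rfl⟩))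
    rw [h.mem_cones_iff]
    intro hc
    obtain ⟨ρ, hρ, hj⟩ := hc j
    exact hρ (by simpa using hj)
  suffices hs : ℓ ∘ₗ Θ.toLinearMap = lcoeff ℚ (fibreDim π) by
    rw [← hΘ]
    exact DFunLike.congr_fun hs _
  refine MvPolynomial.linearMap_ext fun t => LinearMap.ext_ring ?_
  change ℓ (Θ (monomial t 1)) = coeff (fibreDim π) (monomial t (1 : ℚ))
  rw [coeff_monomial]
  split_ifs with ht
  · have hI := h.mem_maxCones_of_section hg
    have h1 := hℓ.2 _ hI
    rw [h.mult_eq_one hI, Nat.cast_one, div_one] at h1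
    rw [ht, ← h.rename_prod_maxCone hI, hΘ, map_prod]
    exact h1
  · by_cases hdeg : t.degree = F.dim
    · have hj : ∃ j, fibreDim π j + 1 ≤ t j := by
        by_contra hcon
        push Not at hcon
        refine ht (Finsupp.ext fun j => ?_)
        have hle : ∀ j ∈ Finset.univ, t j ≤ fibreDim π j :=
          fun j _ => Nat.lt_succ_iff.1 (hcon j)
        rw [← h.degree_fibreDim, Finsupp.degree_eq_sum, Finsupp.degree_eq_sum] at hdeg
        exact (Finset.sum_eq_sum_iff_of_le hle).1 hdeg j (Finset.mem_univ j)
      obtain ⟨j, hj⟩ := hj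
      have hsplit : (monomial t (1 : ℚ)) = X j ^ (fibreDim π j + 1) *
          monomial (t - Finsupp.single j (fibreDim π j + 1)) 1 := by
        rw [X_pow_eq_monomial, monomial_mul, one_mul,
          add_tsub_cancel_of_le (Finsupp.single_le_iff.2 hj)]
      rw [hsplit, map_mul, hX, zero_mul, map_zero]
    · rw [hΘ']
      refine hℓ.1 t.degree _ ?_ hdeg
      exact (isHomogeneous_monomial _ rfl).rename_isHomogeneous

theorem existsUnique_isIntegral : ∃! ℓ, F.IsIntegral ℓ := by
  obtain ⟨ℓ, hℓ⟩ := h.exists_isIntegral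
  refine ⟨ℓ, hℓ, fun ℓ' hℓ' => LinearMap.ext fun x => ?_⟩
  obtain ⟨p, rfl⟩ := Ideal.Quotient.mk_surjective x
  rw [h.isIntegral_apply hℓ, h.isIntegral_apply hℓ']

open MvPolynomial in
theorem integral_mk (p : MvPolynomial ι ℚ) :
    F.integral (Ideal.Quotient.mk _ p) = coeff (fibreDim π) (rename π p) := by
  have hex := h.exists_isIntegral
  rw [FanData.integral, dif_pos hex]
  exact h.isIntegral_apply hex.choose_spec p

end FanData.IsProjProduct

end ProjProduct

/-! ### Homogeneous coordinates on a product of projective spaces -/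

theorem isOpenQuotientMap_projectivization_mk (m : ℕ) :
    IsOpenQuotientMap fun v : {v : Fin (m + 1) → ℂ // v ≠ 0} => Projectivization.mk ℂ v.1 v.2 := by
  refine ⟨Quotient.mk_surjective, continuous_quot_mk, fun V hV => ?_⟩
  refine isOpen_coinduced.2 ?_
  have hcont : ∀ t : ℂˣ, Continuous fun v : {v : Fin (m + 1) → ℂ // v ≠ 0} =>
      (⟨t • v.1, (smul_ne_zero_iff_ne t).2 v.2⟩ : {v : Fin (m + 1) → ℂ // v ≠ 0}) :=
    fun t => (continuous_subtype_val.const_smul t).subtype_mk _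
  -- the saturation of an open set is the union of its preimages under all scalings
  convert isOpen_iUnion fun t : ℂˣ => hV.preimage (hcont t) using 1
  ext v
  simp only [Set.mem_preimage, Set.mem_iUnion]
  constructor
  · rintro ⟨w, hw, hwv⟩
    obtain ⟨t, ht⟩ := (Projectivization.mk_eq_mk_iff ℂ _ _ w.2 v.2).1 hwv
    refine ⟨t, ?_⟩
    convert! hw
  · rintro ⟨t, ht⟩
    exact ⟨_, ht, (Projectivization.mk_eq_mk_iff ℂ _ _ _ v.2).2 ⟨t, rfl⟩⟩

namespace FanData.IsProjProduct

variable {N : Type} [AddCommGroup N] {ι : Type} [Fintype ι] {F : FanData N ι}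

section

variable {κ : Type} [Fintype κ] [DecidableEq κ] {π : ι → κ} (h : F.IsProjProduct π)
include h

theorem mem_U_iff (z : ι → ℂ) : z ∈ F.U ↔ ∀ j, ∃ ρ, π ρ = j ∧ z ρ ≠ 0 := by
  classical
  constructor
  · rintro ⟨I, hI, hz⟩ j
    obtain ⟨ρ, hρ, hj⟩ := (h.mem_cones_iff I).1 hI j
    exact ⟨ρ, hj, hz ρ hρ⟩
  · intro hz
    refine ⟨Finset.univ.filter fun ρ => z ρ = 0, (h.mem_cones_iff _).2 fun j => ?_, by simp⟩
    obtain ⟨ρ, hj, hρ⟩ := hz j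
    exact ⟨ρ, by simpa using hρ, hj⟩

/-- The group of the homogeneous coordinates has one copy of `ℂˣ` for each factor. -/
theorem mem_G_iff (t : ι → ℂˣ) : t ∈ F.G ↔ ∀ ρ σ, π ρ = π σ → t ρ = t σ := by
  classical
  constructor
  · intro ht ρ σ hρ
    obtain ⟨m, hm⟩ := h.exists_hom (Pi.single ρ 1 - Pi.single σ 1) (by
      intro j
      simp [Finset.sum_sub_distrib, hρ])
    have h1 := ht m
    simp only [hm, Pi.sub_apply, zpow_sub, Finset.prod_mul_distrib, Finset.prod_inv_distrib] at h1
    rw [Finset.prod_eq_single ρ (by simp +contextual) (by simp),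
      Finset.prod_eq_single σ (by simp +contextual) (by simp)] at h1
    simpa [mul_inv_eq_one] using h1
  · intro ht m
    rw [← Finset.prod_fiberwise Finset.univ π]
    refine Finset.prod_eq_one fun j _ => ?_
    obtain ⟨σ, hσ⟩ := h.surjective j
    have : ∀ ρ ∈ Finset.univ.filter (fun ρ => π ρ = j),
        t ρ ^ m (F.ray ρ) = t σ ^ m (F.ray ρ) := by
      intro ρ hρ
      rw [ht ρ σ ((Finset.mem_filter.1 hρ).2.trans hσ.symm)]
    rw [Finset.prod_congr rfl this, show ∏ ρ with π ρ = j, t σ ^ m (F.ray ρ) =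
        t σ ^ ∑ ρ with π ρ = j, m (F.ray ρ) from
      (map_sum (zmultiplesHom (Additive ℂˣ) (Additive.ofMul (t σ))) _ _).symm,
      h.sum_hom_ray, zpow_zero]

end

variable {r : ℕ} {s : Fin r → ℕ} {e : ι ≃ Σ j : Fin r, Fin (s j + 1)}

theorem coord_ne_zero (h : F.IsProjProduct fun ρ => (e ρ).1) (z : F.U) (j : Fin r) :
    (fun i => z.1 (e.symm ⟨j, i⟩)) ≠ 0 := by
  obtain ⟨ρ, rfl, hz⟩ := (h.mem_U_iff z.1).1 z.2 j
  intro h0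
  have := congrFun h0 (e ρ).2
  simp only [Sigma.eta, Equiv.symm_apply_apply, Pi.zero_apply] at this
  exact hz this

/-- Grouping the homogeneous coordinates according to the factors. -/
def coordHomeomorph (h : F.IsProjProduct fun ρ => (e ρ).1) :
    F.U ≃ₜ (∀ j, {v : Fin (s j + 1) → ℂ // v ≠ 0}) where
  toFun z j := ⟨fun i => z.1 (e.symm ⟨j, i⟩), h.coord_ne_zero z j⟩
  invFun v := ⟨fun ρ => (v (e ρ).1).1 (e ρ).2, (h.mem_U_iff _).2 fun j => by
    obtain ⟨i, hi⟩ := Function.ne_iff.1 (v j).2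
    exact ⟨e.symm ⟨j, i⟩, by simp, by rw [Equiv.apply_symm_apply]; exact hi⟩⟩
  left_inv z := by ext; simp
  right_inv v := by
    ext j i
    change (v (e (e.symm ⟨j, i⟩)).1).1 (e (e.symm ⟨j, i⟩)).2 = (v j).1 i
    rw [Equiv.apply_symm_apply]
  continuous_toFun := continuous_pi fun j => Continuous.subtype_mk (continuous_pi fun i => by
    exact (continuous_apply (e.symm ⟨j, i⟩)).comp continuous_subtype_val) _
  continuous_invFun := Continuous.subtype_mk (continuous_pi fun ρ => by
    have h1 : Continuous fun v : ∀ j, {v : Fin (s j + 1) → ℂ // v ≠ 0} => (v (e ρ).1).1 :=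
      continuous_subtype_val.comp (continuous_apply _)
    exact (continuous_apply (e ρ).2).comp h1) _

/-- Two points of `U` have the same image in the product of the projective spaces iff they lie in the
same orbit, and the map to this product is an open quotient map, being a product of such. -/
theorem exists_homeomorph (h : F.IsProjProduct fun ρ => (e ρ).1) :
    ∃ Ψ : F.Variety ≃ₜ (∀ j, ℙ ℂ (Fin (s j + 1) → ℂ)), ∀ (z : F.U) (j : Fin r),
      ∃ hz : (fun i => z.1 (e.symm ⟨j, i⟩)) ≠ 0,
        Ψ (F.point z) j = Projectivization.mk ℂ _ hz := by
  set Q : F.U → ∀ j, ℙ ℂ (Fin (s j + 1) → ℂ) :=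
    fun z j => Projectivization.mk ℂ _ (h.coord_ne_zero z j) with hQdef
  have hQ : IsOpenQuotientMap Q :=
    (IsOpenQuotientMap.piMap fun j => isOpenQuotientMap_projectivization_mk (s j)).comp
      h.coordHomeomorph.isOpenQuotientMap
  have hQiff : ∀ z w : F.U, F.orbitSetoid z w ↔ Q z = Q w := by
    intro z w
    constructor
    · rintro ⟨t, ht, hzw⟩
      rw [h.mem_G_iff] at ht
      funext j
      refine ((Projectivization.mk_eq_mk_iff ℂ _ _ _ _).2 ⟨t (e.symm ⟨j, 0⟩), ?_⟩).symm
      funext i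
      rw [Pi.smul_apply, hzw, ht _ (e.symm ⟨j, i⟩) (by simp)]
      rfl
    · intro hzw
      have : ∀ j, ∃ t : ℂˣ, t • (fun i => z.1 (e.symm ⟨j, i⟩)) = fun i => w.1 (e.symm ⟨j, i⟩) :=
        fun j => (Projectivization.mk_eq_mk_iff ℂ _ _ _ _).1 (congrFun hzw j).symm
      choose t ht using this
      refine ⟨fun ρ => t (e ρ).1, (h.mem_G_iff _).2 fun ρ σ hρ => by simp only [hρ],
        fun ρ => ?_⟩
      have := congrFun (ht (e ρ).1) (e ρ).2
      simp only [Pi.smul_apply, Sigma.eta, Equiv.symm_apply_apply] at this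
      exact this.symm
  let q : F.Variety → ∀ j, ℙ ℂ (Fin (s j + 1) → ℂ) :=
    Quotient.lift Q fun z w hzw => (hQiff z w).1 hzw
  have hq : ∀ z, q (F.point z) = Q z := fun _ => rfl
  have hpt : Function.Surjective F.point := Quotient.mk_surjective
  have hbij : Function.Bijective q := by
    constructor
    · intro x y hxy
      obtain ⟨z, rfl⟩ := hpt x
      obtain ⟨w, rfl⟩ := hpt y
      exact Quotient.sound ((hQiff z w).2 hxy)
    · intro y
      obtain ⟨z, rfl⟩ := hQ.surjective y
      exact ⟨F.point z, rfl⟩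
  have hcont : Continuous q := hQ.continuous.quotient_lift _
  have hptc : Continuous F.point := continuous_quot_mk
  have hopen : IsOpenMap q := by
    intro W hW
    have : q '' W = Q '' (F.point ⁻¹' W) := by
      rw [show Q = q ∘ F.point from rfl, Set.image_comp, Set.image_preimage_eq _ hpt]
    rw [this]
    exact hQ.isOpenMap _ (hW.preimage hptc)
  exact ⟨(Equiv.ofBijective q hbij).toHomeomorphOfContinuousOpen hcont hopen,
    fun z j => ⟨h.coord_ne_zero z j, rfl⟩⟩

end FanData.IsProjProduct

/-! ### The fan of a product of projective spaces -/

@[simp] theorem projFan_ray_castSucc (m : ℕ) (i : Fin m) :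
    (projFan m).ray i.castSucc = Pi.single i 1 := by
  simp [projFan]

@[simp] theorem projFan_ray_last (m : ℕ) : (projFan m).ray (Fin.last m) = fun _ => -1 := by
  simp [projFan]

theorem sum_fibre_sigma {r : ℕ} {s : Fin r → ℕ} {A : Type*} [AddCommMonoid A]
    (f : (Σ j : Fin r, Fin (s j + 1)) → A) (j : Fin r) :
    ∑ p with p.1 = j, f p = ∑ i, f ⟨j, i⟩ := by
  rw [Finset.sum_filter, Fintype.sum_sigma, Finset.sum_eq_single j] <;> simp +contextual

section ProdProjFan

variable {r : ℕ} (s : Fin r → ℕ)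

theorem mem_cones_prodProjFan (I : Finset (Σ j : Fin r, Fin (s j + 1))) :
    I ∈ (prodProjFan s).cones ↔ ∀ j, ∃ i, (⟨j, i⟩ : Σ j : Fin r, Fin (s j + 1)) ∉ I := by
  simp [prodProjFan, projFan, Finset.eq_univ_iff_forall]

theorem sum_ray_prodProjFan (j : Fin r) : ∑ i, (prodProjFan s).ray ⟨j, i⟩ = 0 := by
  have h : ∑ i, (projFan (s j)).ray i = 0 := by
    rw [Fin.sum_univ_castSucc]
    ext i
    simp [Finset.sum_apply, Pi.single_apply]
  change ∑ i, AddMonoidHom.single (fun j => Fin (s j) → ℤ) j ((projFan (s j)).ray i) = 0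
  rw [← map_sum, h, map_zero]

/-- Characters of the torus with prescribed values on the rays, for arbitrary coefficients. -/
theorem exists_hom_prodProjFan {A : Type*} [AddCommGroup A]
    (a : (Σ j : Fin r, Fin (s j + 1)) → A) (ha : ∀ j, ∑ i, a ⟨j, i⟩ = 0) :
    ∃ m : (∀ j, Fin (s j) → ℤ) →+ A, ∀ p, m ((prodProjFan s).ray p) = a p := by
  let m : (∀ j, Fin (s j) → ℤ) →+ A :=
    { toFun := fun v => ∑ j, ∑ i, v j i • a ⟨j, i.castSucc⟩
      map_zero' := by simp
      map_add' := fun v w => by simp [add_smul, Finset.sum_add_distrib] }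
  have hm : ∀ j (w : Fin (s j) → ℤ), m (Pi.single j w) = ∑ i, w i • a ⟨j, i.castSucc⟩ := by
    intro j w
    change ∑ j', ∑ i, (Pi.single j w : ∀ j, Fin (s j) → ℤ) j' i • a ⟨j', i.castSucc⟩ = _
    rw [Finset.sum_eq_single j (fun j' _ hj' => by simp [hj']) (by simp)]
    simp
  refine ⟨m, fun ⟨j, i⟩ => ?_⟩
  change m (Pi.single j ((projFan (s j)).ray i)) = _
  rw [hm]
  induction i using Fin.lastCases with
  | cast i => simp [Pi.single_apply]
  | last =>
    have := ha j
    rw [Fin.sum_univ_castSucc] at this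
    simp [eq_neg_of_add_eq_zero_right this]

theorem isProjProduct_prodProjFan : (prodProjFan s).IsProjProduct Sigma.fst where
  surjective j := ⟨⟨j, 0⟩, rfl⟩
  mem_cones_iff I := by
    rw [mem_cones_prodProjFan]
    refine forall_congr' fun j => ⟨fun ⟨i, hi⟩ => ⟨_, hi, rfl⟩, ?_⟩
    rintro ⟨⟨_, i⟩, hi, rfl⟩
    exact ⟨i, hi⟩
  sum_ray j := by rw [sum_fibre_sigma, sum_ray_prodProjFan]
  exists_hom a ha := exists_hom_prodProjFan s a fun j => by rw [← sum_fibre_sigma, ha]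
  closure_ray := by
    rw [eq_top_iff]
    intro v _
    rw [← Finset.univ_sum_single v]
    refine sum_mem fun j _ => ?_
    rw [← Finset.univ_sum_single (v j), ← AddMonoidHom.single_apply, map_sum]
    refine sum_mem fun i _ => ?_
    have : AddMonoidHom.single (fun j => Fin (s j) → ℤ) j (Pi.single i (v j i)) =
        v j i • (prodProjFan s).ray ⟨j, i.castSucc⟩ := by
      change _ = v j i •
        AddMonoidHom.single (fun j => Fin (s j) → ℤ) j ((projFan (s j)).ray i.castSucc)
      rw [← map_zsmul, projFan_ray_castSucc, ← Pi.single_smul]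
      simp
    rw [this]
    exact zsmul_mem (AddSubgroup.subset_closure (Set.mem_range_self _)) _
  dim_add_card := by
    simp [FanData.dim, Module.finrank_pi_fintype, Finset.sum_add_distrib]

variable {s}

/-- The relations among the rays are the classes of curves, determined by a degree in each factor. -/
theorem mem_relations_iff (l : (Σ j : Fin r, Fin (s j + 1)) → ℤ) :
    l ∈ (prodProjFan s).relations ↔ ∃ c : Fin r → ℤ, l = fun p => c p.1 := by
  classical
  constructor
  · intro hl
    change ∑ p, l p • (prodProjFan s).ray p = 0 at hl
    refine ⟨fun j => l ⟨j, 0⟩, funext fun p => ?_⟩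
    obtain ⟨m, hm⟩ := (isProjProduct_prodProjFan s).exists_hom
      (Pi.single p 1 - Pi.single ⟨p.1, 0⟩ 1) (by
        intro j
        simp [Finset.sum_sub_distrib])
    have := congrArg m hl
    simp only [map_sum, map_zsmul, hm, Pi.sub_apply, map_zero, smul_eq_mul, mul_sub,
      Finset.sum_sub_distrib] at this
    rw [Finset.sum_eq_single p (by simp +contextual) (by simp),
      Finset.sum_eq_single (⟨p.1, 0⟩ : Σ j : Fin r, Fin (s j + 1)) (by simp +contextual)
        (by simp)] at this
    simpa [sub_eq_zero] using this
  · rintro ⟨c, rfl⟩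
    change ∑ p, _ • _ = 0
    rw [Fintype.sum_sigma]
    simp only [← Finset.smul_sum, sum_ray_prodProjFan, smul_zero, Finset.sum_const_zero]

/-- An ample divisor has positive degree on each factor. -/
theorem sum_pos_of_isAmple {c : (Σ j : Fin r, Fin (s j + 1)) → ℝ}
    (hc : (prodProjFan s).IsAmple c) (j : Fin r) : 0 < ∑ i, c ⟨j, i⟩ := by
  classical
  have hI := (isProjProduct_prodProjFan s).mem_maxCones_of_section
    (g := fun j => ⟨j, 0⟩) fun _ => rfl
  obtain ⟨m, hm0, hmpos⟩ := hc _ hI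
  have h0 : ∑ i, (c ⟨j, i⟩ + m ((prodProjFan s).ray ⟨j, i⟩)) = ∑ i, c ⟨j, i⟩ := by
    rw [Finset.sum_add_distrib, ← map_sum, sum_ray_prodProjFan, map_zero, add_zero]
  rw [← h0]
  refine Finset.sum_pos' (fun i _ => ?_) ⟨0, Finset.mem_univ _, hmpos _ (by simp)⟩
  by_cases hi : (⟨j, i⟩ : Σ j : Fin r, Fin (s j + 1)) ∈
      (Finset.univ.image fun j => (⟨j, 0⟩ : Σ j : Fin r, Fin (s j + 1)))ᶜ
  · exact (hm0 _ hi).ge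
  · exact (hmpos _ hi).le

theorem isAmple_of_isAmpleCartier {H : (Σ j : Fin r, Fin (s j + 1)) → ℤ}
    (hH : (prodProjFan s).IsAmpleCartier H) : (prodProjFan s).IsAmple fun p => (H p : ℝ) := by
  intro I hI
  obtain ⟨m, h0, hpos⟩ := hH I hI
  refine ⟨(Int.castAddHom ℝ).comp m, fun i hi => ?_, fun i hi => ?_⟩
  · simpa using congrArg (Int.cast : ℤ → ℝ) (h0 i hi)
  · simpa using (Int.cast_pos (R := ℝ)).2 (hpos i hi)

theorem isAmple_of_pos {c : (Σ j : Fin r, Fin (s j + 1)) → ℝ} (hc : ∀ p, 0 < c p) :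
    (prodProjFan s).IsAmple c := by
  classical
  intro I hI
  obtain ⟨g, hg, hgI⟩ := (isProjProduct_prodProjFan s).exists_section hI
  -- on the omitted ray of each factor the character takes the sum of the other coefficients
  obtain ⟨m, hm⟩ := exists_hom_prodProjFan s
    (fun p => (if p = g p.1 then ∑ i, c ⟨p.1, i⟩ else 0) - c p) (by
      intro j
      obtain ⟨i, hgj⟩ : ∃ i, g j = ⟨j, i⟩ := by
        have h1 := hg j
        generalize g j = p at h1 ⊢
        subst h1
        exact ⟨p.2, rfl⟩
      rw [Finset.sum_sub_distrib]
      simp only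
      rw [hgj]
      simp)
  refine ⟨m, fun p hp => ?_, fun p hp => ?_⟩
  · rw [hm, if_neg fun h => (hgI p).2 h hp]
    ring
  · rw [hm, if_pos ((hgI p).1 hp), add_sub_cancel]
    exact Finset.sum_pos (fun i _ => hc _) Finset.univ_nonempty

theorem moriPoints_prodProjFan :
    (prodProjFan s).moriPoints = {β | ∃ b : Fin r → ℕ, β = fun p => (b p.1 : ℤ)} := by
  classical
  ext β
  constructor
  · rintro ⟨hrel, hβ⟩
    obtain ⟨c, rfl⟩ := (mem_relations_iff β).1 hrel
    suffices hc : ∀ j, 0 ≤ c j by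
      exact ⟨fun j => (c j).toNat, funext fun p => (Int.toNat_of_nonneg (hc _)).symm⟩
    -- a large multiple of the divisor of one ray of the factor `j`, added to the sum of all
    -- divisors, detects the sign of `c j`
    intro j
    by_contra hneg
    push Not at hneg
    set S : ℝ := ∑ p : Σ j : Fin r, Fin (s j + 1), |(c p.1 : ℝ)| with hS
    have hS0 : 0 ≤ S := Finset.sum_nonneg fun _ _ => abs_nonneg _
    have hle : ∑ p : Σ j : Fin r, Fin (s j + 1), (c p.1 : ℝ) ≤ S :=
      Finset.sum_le_sum fun _ _ => le_abs_self _
    have h := hβ (fun p => 1 + if p = ⟨j, 0⟩ then S + 1 else 0) (isAmple_of_pos fun p => by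
      split_ifs <;> linarith)
    simp only [add_mul, one_mul, Finset.sum_add_distrib, ite_mul, zero_mul, Finset.sum_ite_eq',
      Finset.mem_univ, if_true] at h
    have hcj : (c j : ℝ) ≤ -1 := by exact_mod_cast Int.le_sub_one_of_lt hneg
    nlinarith
  · rintro ⟨b, rfl⟩
    refine ⟨(mem_relations_iff _).2 ⟨fun j => b j, rfl⟩, fun c hc => ?_⟩
    rw [Fintype.sum_sigma]
    refine Finset.sum_nonneg fun j _ => ?_
    simp only
    rw [← Finset.sum_mul]
    exact mul_nonneg (sum_pos_of_isAmple hc j).le (by positivity)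

end ProdProjFan

/-- Being a fan of a product of projective spaces is invariant under isomorphisms of fans. -/
theorem IsFanIso.isProjProduct {N N' ι ι' : Type} [AddCommGroup N] [AddCommGroup N'] [Fintype ι]
    [Fintype ι'] {κ : Type} [Fintype κ] [DecidableEq κ] {F : FanData N ι} {F' : FanData N' ι'}
    {e : ι ≃ ι'} (he : IsFanIso F F' e) {π : ι' → κ} (h : F'.IsProjProduct π) :
    F.IsProjProduct fun ρ => π (e ρ) := by
  obtain ⟨⟨φ, hφ⟩, hcones⟩ := he
  have hsum : ∀ {A : Type} [AddCommMonoid A] (a : ι → A) (j : κ),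
      ∑ ρ with π (e ρ) = j, a ρ = ∑ ρ with π ρ = j, a (e.symm ρ) := by
    intro A _ a j
    rw [Finset.sum_filter, Finset.sum_filter, ← e.sum_comp]
    simp
  refine ⟨h.surjective.comp e.surjective, fun I => ?_, fun j => ?_, fun a ha => ?_, ?_, ?_⟩
  · rw [hcones, h.mem_cones_iff]
    refine forall_congr' fun j => ⟨?_, ?_⟩
    · rintro ⟨ρ, hρ, hj⟩
      exact ⟨e.symm ρ, fun hmem => hρ (Finset.mem_map.2 ⟨_, hmem, by simp⟩), by simpa using hj⟩
    · rintro ⟨ρ, hρ, hj⟩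
      exact ⟨e ρ, by simpa using hρ, hj⟩
  · apply φ.injective
    rw [map_sum, map_zero, hsum]
    simpa [hφ] using h.sum_ray j
  · obtain ⟨m, hm⟩ := h.exists_hom (fun ρ => a (e.symm ρ)) fun j => by rw [← hsum, ha]
    exact ⟨m.comp φ.toAddMonoidHom, fun ρ => by simp [hφ, hm]⟩
  · rw [eq_top_iff]
    intro v _
    have hv : φ v ∈ AddSubgroup.closure (Set.range F'.ray) := by rw [h.closure_ray]; trivial
    have hmap : (AddSubgroup.closure (Set.range F.ray)).map φ.toAddMonoidHom =
        AddSubgroup.closure (Set.range F'.ray) := by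
      rw [AddMonoidHom.map_closure, ← Set.range_comp, ← e.surjective.range_comp F'.ray]
      congr 2
      exact funext hφ
    rw [← hmap] at hv
    obtain ⟨w, hw, hwv⟩ := hv
    rwa [← φ.injective hwv]
  · rw [Fintype.card_congr e, ← h.dim_add_card, FanData.dim, FanData.dim,
      φ.toIntLinearEquiv.finrank_eq]

/-! ### The Morrison–Plesser fan -/

section MorrisonPlesser

variable {r : ℕ} {d s : Fin r → ℕ}

/-- The coordinates `x_i^{(p)}` regrouped according to the factor of the ray `p`. -/
theorem exists_idxEquiv {b : Fin r → ℕ} {β : (Σ j : Fin r, Fin (d j + 1)) → ℤ}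
    (hβ : β = fun p => (b p.1 : ℤ)) (hs : s = fun j => (d j + 1) * b j + d j) :
    ∃ e : Idx β ≃ Σ j : Fin r, Fin (s j + 1), ∀ ρ, (e ρ).1 = ρ.1.1 := by
  have hcard : ∀ j, Fintype.card (Σ i : Fin (d j + 1), Fin (β ⟨j, i⟩ + 1).toNat) = s j + 1 := by
    intro j
    have : ((b j : ℤ) + 1).toNat = b j + 1 := by omega
    simp only [Fintype.card_sigma, Fintype.card_fin, hβ, hs, this, Finset.sum_const,
      Finset.card_univ, smul_eq_mul]
    ring
  exact ⟨(Equiv.sigmaAssoc fun j i => Fin (β ⟨j, i⟩ + 1).toNat).trans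
    (Equiv.sigmaCongrRight fun j => Fintype.equivFinOfCardEq (hcard j)), fun _ => rfl⟩

variable {β : (Σ j : Fin r, Fin (d j + 1)) → ℤ} {e : Idx β ≃ Σ j : Fin r, Fin (s j + 1)}

theorem sum_idx (he : ∀ ρ, (e ρ).1 = ρ.1.1) {A : Type*} [AddCommMonoid A] (f : Idx β → A)
    (j : Fin r) : ∑ i', ∑ i, f ⟨⟨j, i'⟩, i⟩ = ∑ i, f (e.symm ⟨j, i⟩) := by
  calc ∑ i', ∑ i, f ⟨⟨j, i'⟩, i⟩
      = ∑ p : Σ j : Fin r, Fin (d j + 1) with p.1 = j, ∑ i, f ⟨p, i⟩ :=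
        (sum_fibre_sigma (fun p => ∑ i, f ⟨p, i⟩) j).symm
    _ = ∑ ρ with (e ρ).1 = j, f ρ := by
        rw [Finset.sum_filter, Finset.sum_filter]
        refine Eq.trans (Finset.sum_congr rfl fun p _ => ?_) (Fintype.sum_sigma _).symm
        simp only [he]
        split_ifs <;> simp
    _ = ∑ p : Σ j : Fin r, Fin (s j + 1) with p.1 = j, f (e.symm p) := by
        rw [Finset.sum_filter, Finset.sum_filter, ← e.sum_comp]
        simp
    _ = ∑ i, f (e.symm ⟨j, i⟩) := sum_fibre_sigma _ j

theorem mem_mpPolytope_iff (he : ∀ ρ, (e ρ).1 = ρ.1.1) (H : (Σ j : Fin r, Fin (d j + 1)) → ℤ)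
    (x : Idx β → ℝ) : x ∈ (prodProjFan d).mpPolytope H β ↔
      (∀ ρ, 0 ≤ x ρ) ∧ ∀ j, ∑ i, x (e.symm ⟨j, i⟩) = ∑ i, (H ⟨j, i⟩ : ℝ) := by
  refine and_congr_right fun _ => ?_
  simp_rw [← sum_idx he, mem_relations_iff]
  constructor
  · intro hx j
    have := hx _ ⟨Pi.single j 1, rfl⟩
    simp only [Fintype.sum_sigma, ← Finset.mul_sum] at this
    simpa [Pi.single_apply] using this
  · rintro hx _ ⟨c, rfl⟩
    simp only [Fintype.sum_sigma, ← Finset.mul_sum, hx]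

theorem mem_mpLattice_iff (he : ∀ ρ, (e ρ).1 = ρ.1.1) (x : Idx β → ℤ) :
    x ∈ (prodProjFan d).mpLattice β ↔ ∀ j, ∑ i, x (e.symm ⟨j, i⟩) = 0 := by
  simp_rw [← sum_idx he]
  constructor
  · rintro ⟨m, hm⟩ j
    simp_rw [hm]
    rw [← map_sum, sum_ray_prodProjFan, map_zero]
  · intro hx
    obtain ⟨m, hm⟩ := exists_hom_prodProjFan d (fun p => ∑ i, x ⟨p, i⟩) hx
    exact ⟨m, fun p => (hm p).symm⟩

/-- The lattice of `ℙ_β` is that of the product of projective spaces: both are dual to the lattice of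
the vectors all of whose fibre sums vanish. -/
theorem exists_addEquiv_mpFan (he : ∀ ρ, (e ρ).1 = ρ.1.1)
    (H : (Σ j : Fin r, Fin (d j + 1)) → ℤ) :
    ∃ φ : ((prodProjFan d).mpLattice β →+ ℤ) ≃+ (∀ j, Fin (s j) → ℤ),
      ∀ ρ, φ (((prodProjFan d).mpFan H β).ray ρ) = (prodProjFan s).ray (e ρ) := by
  obtain ⟨ψ, hψ⟩ := exists_hom_prodProjFan s
    (fun p => ((prodProjFan d).mpFan H β).ray (e.symm p)) (fun j => by
      ext x
      rw [AddMonoidHom.finsetSum_apply]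
      exact (mem_mpLattice_iff he x.1).1 x.2 j)
  -- the isomorphism of the character lattices
  let Θ : ((∀ j, Fin (s j) → ℤ) →+ ℤ) →+ (prodProjFan d).mpLattice β :=
    { toFun := fun m => ⟨fun ρ => m ((prodProjFan s).ray (e ρ)), (mem_mpLattice_iff he _).2 fun j => by
        simp only [Equiv.apply_symm_apply]
        rw [← map_sum, sum_ray_prodProjFan, map_zero]⟩
      map_zero' := rfl
      map_add' := fun _ _ => rfl }
  have hΘ : Function.Surjective Θ := by
    intro x
    obtain ⟨m, hm⟩ := exists_hom_prodProjFan s (fun p => x.1 (e.symm p))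
      ((mem_mpLattice_iff he x.1).1 x.2)
    exact ⟨m, Subtype.ext (funext fun ρ => by simp [Θ, hm])⟩
  have hdual : ∀ m v, ψ v (Θ m) = m v := by
    intro m v
    have : (AddMonoidHom.eval (Θ m)).comp ψ = m := by
      refine AddMonoidHom.eq_of_eqOn_dense (isProjProduct_prodProjFan s).closure_ray ?_
      rintro _ ⟨p, rfl⟩
      change ψ ((prodProjFan s).ray p) (Θ m) = _
      rw [hψ]
      change m ((prodProjFan s).ray (e (e.symm p))) = _
      rw [Equiv.apply_symm_apply]
    exact DFunLike.congr_fun this v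
  let coord : ∀ j, Fin (s j) → ((∀ j, Fin (s j) → ℤ) →+ ℤ) := fun j i =>
    (Pi.evalAddMonoidHom (fun _ => ℤ) i).comp (Pi.evalAddMonoidHom (fun j => Fin (s j) → ℤ) j)
  have hbij : Function.Bijective ψ := by
    constructor
    · refine (injective_iff_map_eq_zero ψ).2 fun v hv => ?_
      funext j i
      have := hdual (coord j i) v
      rw [hv] at this
      exact this.symm
    · intro f
      refine ⟨fun j i => f (Θ (coord j i)), AddMonoidHom.ext fun x => ?_⟩
      obtain ⟨m, rfl⟩ := hΘ x
      rw [hdual]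
      have hm : m = ∑ j, ∑ i, m (Pi.single j (Pi.single i 1)) • coord j i := by
        ext j i
        simp only [coord, AddMonoidHom.comp_apply, AddMonoidHom.single_apply,
          AddMonoidHom.finsetSum_apply, AddMonoidHom.zsmul_apply, Pi.evalAddMonoidHom_apply,
          smul_eq_mul]
        rw [Finset.sum_eq_single j (fun j' _ hj' => by simp [hj']) (by simp),
          Finset.sum_eq_single i (fun i' _ hi' => by simp [hi']) (by simp)]
        simp
      refine (DFunLike.congr_fun hm _).trans ?_
      conv_rhs => rw [hm]
      simp [coord, AddMonoidHom.finsetSum_apply]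
  refine ⟨(AddEquiv.ofBijective ψ hbij).symm, fun ρ => ?_⟩
  rw [AddEquiv.symm_apply_eq, AddEquiv.ofBijective_apply, hψ, Equiv.symm_apply_apply]

theorem isFanIso_mpFan (he : ∀ ρ, (e ρ).1 = ρ.1.1) {H : (Σ j : Fin r, Fin (d j + 1)) → ℤ}
    (hH : (prodProjFan d).IsAmpleCartier H) :
    IsFanIso ((prodProjFan d).mpFan H β) (prodProjFan s) e := by
  classical
  refine ⟨exists_addEquiv_mpFan he H, fun I => ?_⟩
  have hpos := sum_pos_of_isAmple (isAmple_of_isAmpleCartier hH)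
  rw [mem_cones_prodProjFan]
  constructor
  · rintro ⟨x, hx, hI⟩ j
    by_contra! hj
    refine (hpos j).ne ?_
    rw [← ((mem_mpPolytope_iff he H x).1 hx).2 j]
    refine (Finset.sum_eq_zero fun i _ => hI _ ?_).symm
    obtain ⟨ρ, hρ, hρe⟩ := Finset.mem_map.1 (hj i)
    rw [← hρe]
    simpa using hρ
  · intro hI
    choose i hi using hI
    refine ⟨fun ρ => if (e ρ).2 = i (e ρ).1 then ∑ i', (H ⟨(e ρ).1, i'⟩ : ℝ) else 0,
      (mem_mpPolytope_iff he H _).2 ⟨fun ρ => ?_, fun j => ?_⟩, fun ρ hρ => if_neg fun h => ?_⟩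
    · split_ifs
      · exact (hpos _).le
      · exact le_rfl
    · have : ∀ i₀, (if (e (e.symm ⟨j, i₀⟩)).2 = i (e (e.symm ⟨j, i₀⟩)).1 then
          ∑ i', (H ⟨(e (e.symm ⟨j, i₀⟩)).1, i'⟩ : ℝ) else 0) =
          if i₀ = i j then ∑ i', (H ⟨j, i'⟩ : ℝ) else 0 := by
        intro i₀
        rw [Equiv.apply_symm_apply]
      rw [Finset.sum_congr rfl fun i₀ _ => this i₀]
      simp
    · refine hi (e ρ).1 ?_
      rw [← h]
      exact Finset.mem_map.2 ⟨ρ, hρ, rfl⟩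

/-! ### Intersection numbers -/

open MvPolynomial in
/-- The multinomial theorem, in the form in which it computes intersection numbers on a product of
projective spaces. -/
theorem coeff_monomial_mul_linear_pow {κ : Type*} [Fintype κ] (n : κ → ℕ) (K t : κ →₀ ℕ) (M : ℕ)
    (hM : M + K.degree = t.degree) :
    coeff t (monomial K (1 : ℚ) * (∑ j, (n j : ℚ) • X j) ^ M) =
      M.factorial * ∏ j, (invFactorial ((t j : ℤ) - K j) * (n j : ℚ) ^ ((t j : ℤ) - K j)) := by
  classical
  rw [coeff_monomial_mul', one_mul]
  split_ifs with hK
  · obtain ⟨u, rfl⟩ := exists_add_of_le hK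
    have hu : u.degree = M := by
      rw [map_add] at hM
      omega
    rw [add_tsub_cancel_left, coeff_linearCombination_X_pow_of_fintype, if_pos (show u.sum (fun _ m => m) = M from hu),
      Finsupp.prod_fintype _ _ (by simp), Finset.prod_mul_distrib, ← mul_assoc]
    have hdiff : ∀ j, (((K + u) j : ℕ) : ℤ) - K j = u j := by
      intro j
      simp
    simp only [hdiff, zpow_natCast, invFactorial, Int.natCast_nonneg, if_true, Int.toNat_natCast]
    congr 1
    have h1 := Nat.multinomial_spec Finset.univ (u : κ → ℕ)
    rw [← Finsupp.multinomial_eq_of_support_subset (Finset.subset_univ _),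
      ← Finsupp.degree_eq_sum, hu] at h1
    rw [← h1, Nat.cast_mul, Nat.cast_prod, mul_right_comm, ← Finset.prod_mul_distrib,
      Finset.prod_eq_one, one_mul]
    intro j _
    rw [mul_one_div, div_self]
    exact_mod_cast Nat.factorial_ne_zero _
  · obtain ⟨j, hj⟩ := not_forall.1 fun hle => hK hle
    rw [Finset.prod_eq_zero (Finset.mem_univ j), mul_zero]
    rw [invFactorial, if_neg (by omega), zero_mul]

theorem fibreDim_idx (e : Idx β ≃ Σ j : Fin r, Fin (s j + 1)) (j : Fin r) :
    fibreDim (fun ρ => (e ρ).1) j = s j := by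
  have : (Finset.univ.filter fun ρ => (e ρ).1 = j).card = s j + 1 := by
    rw [Finset.card_filter, e.sum_comp (fun p => if p.1 = j then 1 else 0), ← Finset.sum_filter,
      sum_fibre_sigma]
    simp
  simp [fibreDim, this]

open MvPolynomial in
theorem mpNumber_monomial {b : Fin r → ℕ} (hβ : β = fun p => (b p.1 : ℤ))
    (hs : s = fun j => (d j + 1) * b j + d j)
    {H : (Σ j : Fin r, Fin (d j + 1)) → ℤ} (hH : (prodProjFan d).IsAmpleCartier H)
    (k : (Σ j : Fin r, Fin (d j + 1)) →₀ ℕ) (hk : k.degree = ∑ j, d j) :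
    (prodProjFan d).mpNumber H (monomial k 1) β =
      (∑ j, (d j + 1) * b j).factorial * ∏ j,
        (invFactorial ((d j + 1) * b j + d j - ∑ i, (k ⟨j, i⟩ : ℤ)) *
          ((d j + 1 : ℕ) : ℚ) ^ ((d j + 1) * b j + d j - ∑ i, (k ⟨j, i⟩ : ℤ))) := by
  classical
  obtain ⟨e, he⟩ := exists_idxEquiv hβ hs
  have h := (isFanIso_mpFan he hH).isProjProduct (isProjProduct_prodProjFan s)
  have hnn : ∀ p, 0 ≤ β p := fun p => by rw [hβ]; positivity
  let ρ₀ : ∀ p, Idx β := fun p => ⟨p, ⟨0, by have := hnn p; omega⟩⟩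
  have hdiv : (prodProjFan d).mpDivisor H β =
      fun p => ((prodProjFan d).mpFan H β).divisor (ρ₀ p) := by
    funext p
    rw [FanData.mpDivisor, dif_pos (hnn p)]
  have hM : (∑ p, β p).toNat = ∑ j, (d j + 1) * b j := by
    have : ∑ p, β p = ((∑ j, (d j + 1) * b j : ℕ) : ℤ) := by
      rw [Fintype.sum_sigma, hβ]
      simp
    rw [this, Int.toNat_natCast]
  have hempty : (Finset.univ.filter fun p => β p < 0) = ∅ :=
    Finset.filter_eq_empty_iff.2 fun p _ => (hnn p).not_gt
  have hmk : aeval ((prodProjFan d).mpDivisor H β) (monomial k (1 : ℚ)) *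
      (prodProjFan d).mpClass H β = Ideal.Quotient.mk _
        (rename ρ₀ (monomial k 1 * (∑ p, X p) ^ (∑ j, (d j + 1) * b j))) := by
    have haeval : ∀ q : MvPolynomial (Σ j : Fin r, Fin (d j + 1)) ℚ,
        aeval ((prodProjFan d).mpDivisor H β) q = Ideal.Quotient.mk _ (rename ρ₀ q) := by
      intro q
      have : aeval ((prodProjFan d).mpDivisor H β) =
          (Ideal.Quotient.mkₐ ℚ (((prodProjFan d).mpFan H β).srIdeal ⊔
            ((prodProjFan d).mpFan H β).linIdeal)).comp (rename ρ₀) := by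
        ext p
        rw [aeval_X, hdiv, AlgHom.comp_apply, rename_X]
        rfl
      rw [this]
      rfl
    rw [← haeval, map_mul, map_pow, map_sum, FanData.mpClass, hM, hempty, Finset.prod_empty,
      mul_one]
    simp only [aeval_X]
  rw [FanData.mpNumber, hmk, h.integral_mk, rename_rename]
  -- the image of the form in the hyperplane classes of the factors
  have hcomp : (fun ρ => (e ρ).1) ∘ ρ₀ = Sigma.fst := funext fun p => he _
  rw [hcomp, map_mul, map_pow, rename_monomial, map_sum]
  have hsum : ∑ p : Σ j : Fin r, Fin (d j + 1), rename (R := ℚ) Sigma.fst (X p) =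
      ∑ j, ((d j + 1 : ℕ) : ℚ) • X j := by
    simp only [rename_X]
    rw [Fintype.sum_sigma]
    refine Finset.sum_congr rfl fun j _ => ?_
    simp [← Nat.cast_smul_eq_nsmul ℚ]
  have hK : ∀ j, k.mapDomain Sigma.fst j = ∑ i, k ⟨j, i⟩ := by
    intro j
    rw [← sum_fibre_sigma, Finsupp.mapDomain, Finsupp.sum_fintype _ _ (by simp),
      Finsupp.finsetSum_apply, Finset.sum_filter]
    refine Finset.sum_congr rfl fun p _ => ?_
    rw [Finsupp.single_apply]
  rw [hsum, coeff_monomial_mul_linear_pow]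
  · congr 1
    refine Finset.prod_congr rfl fun j _ => ?_
    rw [fibreDim_idx e, hK, hs]
    push_cast
    rfl
  · have hKdeg : (k.mapDomain Sigma.fst).degree = ∑ j, d j := by
      rw [← hk, Finsupp.degree_eq_sum, Finsupp.degree_eq_sum, Fintype.sum_sigma]
      exact Finset.sum_congr rfl fun j _ => hK j
    rw [hKdeg, Finsupp.degree_eq_sum, ← Finset.sum_add_distrib]
    refine Finset.sum_congr rfl fun j _ => ?_
    rw [fibreDim_idx e, hs]

/-! ### The generating function -/

/-- The exponent vector `β` of the curve class with degrees `b`. -/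
noncomputable def curveExponent (d b : Fin r → ℕ) : (Σ j : Fin r, Fin (d j + 1)) →₀ ℕ :=
  Finsupp.equivFunOnFinite.symm fun p => b p.1

theorem curveExponent_injective (d : Fin r → ℕ) : Function.Injective (curveExponent d) := by
  intro b b' hb
  funext j
  exact DFunLike.congr_fun hb ⟨j, 0⟩

open MvPowerSeries in
theorem monomial_curveExponent (b : Fin r → ℕ) (c : ℚ) (u : Fin r → ℚ) :
    C c * ∏ j, (C (u j) * ∏ i : Fin (d j + 1),
      X (⟨j, i⟩ : Σ j : Fin r, Fin (d j + 1))) ^ b j =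
      monomial (curveExponent d b) (c * ∏ j, u j ^ b j) := by
  rw [← MvPolynomial.coe_monomial, MvPolynomial.monomial_eq,
    Finsupp.prod_fintype _ _ (by simp), Fintype.prod_sigma]
  simp only [← MvPolynomial.coeToMvPowerSeries.ringHom_apply, map_mul, map_prod, map_pow]
  simp only [MvPolynomial.coeToMvPowerSeries.ringHom_apply, MvPolynomial.coe_C,
    MvPolynomial.coe_X, mul_pow, Finset.prod_mul_distrib, mul_assoc, ← Finset.prod_pow]
  rfl

open MvPowerSeries MvPowerSeries.WithPiTopology in
theorem hasSum_mpSeries (H : (Σ j : Fin r, Fin (d j + 1)) → ℤ)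
    (P : MvPolynomial (Σ j : Fin r, Fin (d j + 1)) ℚ) :
    HasSum (fun b : Fin r → ℕ => monomial (curveExponent d b)
      ((prodProjFan d).mpNumber H P fun p => (b p.1 : ℤ))) ((prodProjFan d).mpSeries H P) := by
  have hcoeff : ∀ b, coeff (curveExponent d b) ((prodProjFan d).mpSeries H P) =
      (prodProjFan d).mpNumber H P fun p => (b p.1 : ℤ) := by
    intro b
    refine if_pos ?_
    rw [moriPoints_prodProjFan]
    exact ⟨b, rfl⟩
  simp_rw [← hcoeff]
  refine ((curveExponent_injective d).hasSum_iff fun x hx => ?_).2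
    (hasSum_of_monomials_self ((prodProjFan d).mpSeries H P))
  have : coeff x ((prodProjFan d).mpSeries H P) = 0 := by
    refine if_neg fun hmem => hx ?_
    rw [moriPoints_prodProjFan] at hmem
    obtain ⟨b, hb⟩ := hmem
    exact ⟨b, Finsupp.ext fun p => by exact_mod_cast (congrFun hb p).symm⟩
  rw [this, map_zero]

end MorrisonPlesser

end ToricMP

open ToricMP MvPowerSeries MvPowerSeries.WithPiTopology in
theorem mainTheorem5 {r : ℕ} (d : Fin r → ℕ) (hd : ∀ j, 1 ≤ d j)
    (H : (Σ j : Fin r, Fin (d j + 1)) → ℤ) (hH : (prodProjFan d).IsAmpleCartier H) :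
    -- the integral points of the Mori cone are identified with `ℕ^r`
    ((prodProjFan d).moriPoints = {β | ∃ b : Fin r → ℕ, β = fun p => (b p.1 : ℤ)}) ∧
    -- the Morrison–Plesser spaces are products of projective spaces
    (∀ b : Fin r → ℕ, ∀ β : (Σ j : Fin r, Fin (d j + 1)) → ℤ, (β = fun p => (b p.1 : ℤ)) →
      ∀ s : Fin r → ℕ, (s = fun j => (d j + 1) * b j + d j) →
      (∃ e : Idx β ≃ (Σ j : Fin r, Fin (s j + 1)),
        IsFanIso ((prodProjFan d).mpFan H β) (prodProjFan s) e ∧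
        ∃ Ψ : ((prodProjFan d).mpFan H β).Variety ≃ₜ (∀ j, ℙ ℂ (Fin (s j + 1) → ℂ)),
          ∀ (z : ((prodProjFan d).mpFan H β).U) (j : Fin r),
            ∃ hz : (fun i => z.1 (e.symm ⟨j, i⟩)) ≠ 0,
              Ψ (((prodProjFan d).mpFan H β).point z) j = Projectivization.mk ℂ _ hz) ∧
      ∃! ℓ, ((prodProjFan d).mpFan H β).IsIntegral ℓ) ∧
    -- the generating function of the intersection numbers `I(x^k, β)`
    ∀ k : (Σ j : Fin r, Fin (d j + 1)) →₀ ℕ, k.degree = ∑ j, d j →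
      HasSum
        (fun b : Fin r → ℕ =>
          C ((∏ j, ((d j + 1 : ℕ) : ℚ) ^ ((d j : ℤ) - ∑ i, (k ⟨j, i⟩ : ℤ))) *
              ((∑ j, (d j + 1) * b j).factorial *
                ∏ j, invFactorial ((d j + 1) * b j + d j - ∑ i, (k ⟨j, i⟩ : ℤ)))) *
            ∏ j, (C (((d j + 1 : ℕ) : ℚ) ^ (d j + 1)) *
              ∏ i : Fin (d j + 1), X (⟨j, i⟩ : Σ j : Fin r, Fin (d j + 1))) ^ b j)
        ((prodProjFan d).mpSeries H (MvPolynomial.monomial k 1)) := by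
  refine ⟨moriPoints_prodProjFan, ?_, fun k hk => ?_⟩
  · intro b β hβ s hs
    obtain ⟨e, he⟩ := exists_idxEquiv hβ hs
    have hiso := isFanIso_mpFan he hH
    have h := hiso.isProjProduct (isProjProduct_prodProjFan s)
    exact ⟨⟨e, hiso, h.exists_homeomorph⟩, h.existsUnique_isIntegral⟩
  · convert! hasSum_mpSeries H (MvPolynomial.monomial k 1) using 2 with b
    rw [monomial_curveExponent, mpNumber_monomial rfl rfl hH k hk]
    congr 1
    rw [mul_comm (∏ j, _), mul_assoc, mul_assoc, ← Finset.prod_mul_distrib,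
      ← Finset.prod_mul_distrib]
    congr 2
    funext j
    congr 1
    have hn : ((d j + 1 : ℕ) : ℚ) ≠ 0 := by positivity
    rw [← pow_mul, ← zpow_natCast, ← zpow_add₀ hn]
    congr 1
    push_cast
    ring
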